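/- Let $\mathbb{F}_q$ be a finite field of odd characteristic and let $K=\mathbb{F}_q(t)$. For every integer $d\geq 1$, let $E_d$ be the elliptic curve over $K$ given by the Weierstrass equation $$E_d:\quad y^2=x\cdot\big(x^2+t^{2d}\cdot x-4t^{2d}\big).$$ Then the point $P_d=(2t^d,\,2t^{2d})\in E_d(K)$ has infinite order. In particular, the Mordell--Weil group $E_d(K)$ has positive rank. -/

import Mathlib

noncomputable section

/-- The Weierstrass curve `E_d : y² = x (x² + t^{2d} x - 4 t^{2d})` over the rational function
field `K = F(t)`, where `t = RatFunc.X`. -/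
def curveE (F : Type*) [Field F] (d : ℕ) : WeierstrassCurve (RatFunc F) where
  a₁ := 0
  a₂ := RatFunc.X ^ (2 * d)
  a₃ := 0
  a₄ := -4 * RatFunc.X ^ (2 * d)
  a₆ := 0

theorem ratFunc_two_ne_zero {F : Type*} [Field F] (hF : ringChar F ≠ 2) :
    (2 : RatFunc F) ≠ 0 := by
  have h : (2 : F) ≠ 0 := Ring.two_ne_zero hF
  have h' := (map_ne_zero (RatFunc.C (K := F))).mpr h
  rwa [map_ofNat] at h'

theorem curveE_discr (F : Type*) [Field F] (d : ℕ) :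
    (curveE F d).Δ = 2 ^ 8 * RatFunc.X ^ (6 * d) * (RatFunc.X ^ (2 * d) + 16) := by
  simp only [curveE, WeierstrassCurve.Δ, WeierstrassCurve.b₂, WeierstrassCurve.b₄,
    WeierstrassCurve.b₆, WeierstrassCurve.b₈]
  ring

/-- In characteristic different from `2` and for `d ≥ 1`, the curve `E_d` is an elliptic curve. -/
theorem curveE_isElliptic {F : Type*} [Field F] (hF : ringChar F ≠ 2) {d : ℕ} (hd : 1 ≤ d) :
    (curveE F d).IsElliptic := by
  refine ⟨isUnit_iff_ne_zero.mpr ?_⟩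
  rw [curveE_discr]
  refine mul_ne_zero (mul_ne_zero (pow_ne_zero _ (ratFunc_two_ne_zero hF))
    (pow_ne_zero _ RatFunc.X_ne_zero)) ?_
  have h : (Polynomial.X ^ (2 * d) + Polynomial.C (16 : F)) ≠ 0 :=
    Polynomial.X_pow_add_C_ne_zero (by omega) _
  have h' := (map_ne_zero_iff _ (RatFunc.algebraMap_injective F)).mpr h
  rwa [map_add, map_pow, RatFunc.algebraMap_X, RatFunc.algebraMap_C, map_ofNat] at h'

/-- The coordinates of `P_d` define a (nonsingular) point of the affine model of `E_d`. -/
theorem pointP_nonsingular {F : Type*} [Field F] (hF : ringChar F ≠ 2) {d : ℕ} (hd : 1 ≤ d) :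
    (curveE F d).toAffine.Nonsingular (2 * RatFunc.X ^ d) (2 * RatFunc.X ^ (2 * d)) := by
  have := curveE_isElliptic hF hd
  rw [← WeierstrassCurve.Affine.equation_iff_nonsingular,
    WeierstrassCurve.Affine.equation_iff]
  simp only [curveE]
  ring

/-- The point `P_d = (2 t^d, 2 t^{2d})` of `E_d(K)`, `K = F(t)`. -/
def pointP {F : Type*} [Field F] (hF : ringChar F ≠ 2) {d : ℕ} (hd : 1 ≤ d) :
    (curveE F d).toAffine.Point :=
  .some (2 * RatFunc.X ^ d) (2 * RatFunc.X ^ (2 * d)) (pointP_nonsingular hF hd)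

end

open Polynomial

/-! Put `w = t^(2d)`. The point `2P` has `x = 4`, and `4P` has `x = (w + 4)² / 16`, with a pole at
infinity. From `4P` on, the duplication formula never allows cancellation
(`IsGoodFraction.isCoprime_doubleX`), and the larger degree of the numerator makes its leading term
dominate, so each doubling multiplies the numerator degree by 4. The points `2^(k+2) P` thus have
pairwise distinct `x`-coordinates, and `P` has infinitely many multiples. -/

theorem IsCoprime.of_eq_add_mul {R : Type*} [CommRing R] {x y z : R} (h : IsCoprime x y) (c : R)
    (e : z = x + y * c) : IsCoprime z y :=
  e ▸ h.add_mul_left_left c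

section XCoordDoubling

variable {F : Type*} [Field F]

/-- The duplication map on the `x`-line of `y² = x (x² + w x - 4 w)`, written on pairs
(numerator, denominator) of polynomials. -/
noncomputable def doubleX (w : F[X]) (p : F[X] × F[X]) : F[X] × F[X] :=
  ((p.1 ^ 2 + 4 * w * p.2 ^ 2) ^ 2,
    4 * p.1 * p.2 * (p.1 ^ 2 + (w * p.1 * p.2 - 4 * w * p.2 ^ 2)))

/-- The fraction `p.1 / p.2` is reduced, it avoids the singular points of the reductions of
`y² = x (x² + w x - 4 w)` at the primes dividing `w` and `w + 16`, and its pole at infinity has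
order `2 * deg w`. -/
structure IsGoodFraction (w : F[X]) (p : F[X] × F[X]) : Prop where
  isCoprime : IsCoprime p.1 p.2
  isCoprime_left : IsCoprime p.1 w
  isCoprime_sub : IsCoprime (p.1 - 8 * p.2) (w + 16)
  snd_ne_zero : p.2 ≠ 0
  natDegree_fst : p.1.natDegree = p.2.natDegree + 2 * w.natDegree

theorem polynomial_isUnit_four (hF : ringChar F ≠ 2) : IsUnit (4 : F[X]) := by
  have h : (2 : F) ≠ 0 := Ring.two_ne_zero hF
  have h4 : (4 : F) ≠ 0 := by
    have := mul_ne_zero h h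
    norm_num at this
    exact this
  have := Polynomial.isUnit_C.mpr (isUnit_iff_ne_zero.mpr h4)
  rwa [map_ofNat] at this

/-- A common prime factor would send the reduced fraction to a singular point: `x = 0` modulo `w`,
or the node `x = 8` modulo `w + 16`, where `x² + w x - 4 w` becomes `(x - 8)²`. -/
theorem IsGoodFraction.isCoprime_doubleX (hF : ringChar F ≠ 2) {w : F[X]} {p : F[X] × F[X]}
    (h : IsGoodFraction w p) : IsCoprime (doubleX w p).1 (doubleX w p).2 := by
  obtain ⟨a, b⟩ := p
  obtain ⟨hab, haw, hn, -, -⟩ := h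
  simp only at hab haw hn
  have h4 := polynomial_isUnit_four hF
  have unit4 (z : F[X]) : IsCoprime z 4 := isCoprime_one_right.of_isCoprime_of_dvd_right h4.dvd
  have hA : IsCoprime (a ^ 2 + 4 * w * b ^ 2) a := by
    have : IsCoprime (4 * w * b ^ 2) a :=
      (((unit4 a).mul_right haw).mul_right hab.pow_right).symm
    simpa [pow_two, add_comm] using this.add_mul_left_left a
  have hB : IsCoprime (a ^ 2 + 4 * w * b ^ 2) b :=
    (hab.pow_left (m := 2)).of_eq_add_mul (4 * w * b) (by ring)
  have hw : IsCoprime (a ^ 2 + 4 * w * b ^ 2) w :=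
    (haw.pow_left (m := 2)).of_eq_add_mul (4 * b ^ 2) (by ring)
  have hab8 : IsCoprime b (a - 8 * b) :=
    (hab.of_eq_add_mul (-8) (by ring)).symm
  have hnode : IsCoprime (a ^ 2 + 4 * w * b ^ 2) (a - 8 * b) := by
    have h1 : IsCoprime (4 * b ^ 2 * (w + 16)) (a - 8 * b) :=
      ((unit4 _).symm.mul_left hab8.pow_left).mul_left hn.symm
    exact h1.of_eq_add_mul (a + 8 * b) (by ring)
  refine IsCoprime.pow_left ?_
  refine (((unit4 _).mul_right hA).mul_right hB).mul_right ?_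
  -- The last factor is `(a² + 4wb²) + wb(a - 8b)`.
  exact (((hw.mul_right hB).mul_right hnode).symm.of_eq_add_mul 1 (by ring)).symm

theorem IsGoodFraction.doubleX (hF : ringChar F ≠ 2) {w : F[X]} (hw : 0 < w.natDegree)
    {p : F[X] × F[X]} (h : IsGoodFraction w p) :
    IsGoodFraction w (doubleX w p) ∧ (doubleX w p).1.natDegree = 4 * p.1.natDegree := by
  have hcop := h.isCoprime_doubleX hF
  obtain ⟨a, b⟩ := p
  obtain ⟨hab, haw, hn, hb, hdeg⟩ := h
  simp only at hab haw hn hb hdeg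
  have h4 := (polynomial_isUnit_four hF).ne_zero
  have ha : a ≠ 0 := by rintro rfl; simp at hdeg; omega
  have hw0 : w ≠ 0 := by rintro rfl; simp at hw
  have d1 : (4 * w * b ^ 2).natDegree = w.natDegree + 2 * b.natDegree := by
    rw [natDegree_mul (mul_ne_zero h4 hw0) (pow_ne_zero _ hb), natDegree_mul h4 hw0,
      natDegree_pow, natDegree_ofNat, zero_add]
  have d2 : (w * a * b).natDegree = w.natDegree + a.natDegree + b.natDegree := by
    rw [natDegree_mul (mul_ne_zero hw0 ha) hb, natDegree_mul hw0 ha]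
  have e1 : (a ^ 2 + 4 * w * b ^ 2).natDegree = 2 * a.natDegree := by
    rw [natDegree_add_eq_left_of_natDegree_lt, natDegree_pow]
    rw [d1, natDegree_pow]; omega
  have e2 : (a ^ 2 + (w * a * b - 4 * w * b ^ 2)).natDegree = 2 * a.natDegree := by
    rw [natDegree_add_eq_left_of_natDegree_lt, natDegree_pow]
    refine (natDegree_sub_le _ _).trans_lt ?_
    rw [d1, d2, natDegree_pow, max_lt_iff]; omega
  have n2 : a ^ 2 + (w * a * b - 4 * w * b ^ 2) ≠ 0 := by
    intro h0; rw [h0, natDegree_zero] at e2; omega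
  have eA : ((a ^ 2 + 4 * w * b ^ 2) ^ 2).natDegree = 4 * a.natDegree := by
    rw [natDegree_pow, e1]; ring
  have eB : (4 * a * b * (a ^ 2 + (w * a * b - 4 * w * b ^ 2))).natDegree
      = 3 * a.natDegree + b.natDegree := by
    rw [natDegree_mul (mul_ne_zero (mul_ne_zero h4 ha) hb) n2, natDegree_mul (mul_ne_zero h4 ha) hb,
      natDegree_mul h4 ha, e2, natDegree_ofNat]
    ring
  refine ⟨⟨hcop, ?_, ?_, ?_, ?_⟩, eA⟩
  · refine IsCoprime.pow_left ?_
    exact (haw.pow_left (m := 2)).of_eq_add_mul (4 * b ^ 2) (by ring)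
  -- At `w = -16` the new numerator minus 8 times the new denominator is `(a - 8b)^4`.
  · refine (hn.pow_left (m := 4)).of_eq_add_mul
      (-24 * a ^ 2 * b ^ 2 + 128 * a * b ^ 3 + 16 * (w - 16) * b ^ 4) ?_
    simp only [_root_.doubleX]
    ring
  · exact mul_ne_zero (mul_ne_zero (mul_ne_zero h4 ha) hb) n2
  · simp only [_root_.doubleX]
    rw [eA, eB]; omega

theorem IsGoodFraction.iterate_doubleX (hF : ringChar F ≠ 2) {w : F[X]} (hw : 0 < w.natDegree)
    {p : F[X] × F[X]} (h : IsGoodFraction w p) (k : ℕ) :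
    IsGoodFraction w ((_root_.doubleX w)^[k] p) := by
  induction k with
  | zero => exact h
  | succ k ih =>
    rw [Function.iterate_succ_apply']
    exact (ih.doubleX hF hw).1

theorem IsGoodFraction.strictMono_natDegree (hF : ringChar F ≠ 2) {w : F[X]}
    (hw : 0 < w.natDegree) {p : F[X] × F[X]} (h : IsGoodFraction w p) :
    StrictMono fun k : ℕ ↦ ((_root_.doubleX w)^[k] p).1.natDegree := by
  refine strictMono_nat_of_lt_succ fun k ↦ ?_
  have hk := h.iterate_doubleX hF hw k
  rw [Function.iterate_succ_apply', (hk.doubleX hF hw).2]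
  have := hk.natDegree_fst
  omega

/-- Reduced numerators are unique up to units. -/
theorem natDegree_eq_of_div_eq {a b c e : F[X]} (hab : IsCoprime a b) (hce : IsCoprime c e)
    (hb : b ≠ 0) (he : e ≠ 0)
    (h : algebraMap F[X] (RatFunc F) a / algebraMap F[X] (RatFunc F) b =
      algebraMap F[X] (RatFunc F) c / algebraMap F[X] (RatFunc F) e) :
    a.natDegree = c.natDegree := by
  rw [div_eq_div_iff (RatFunc.algebraMap_ne_zero hb) (RatFunc.algebraMap_ne_zero he),
    ← map_mul, ← map_mul] at h
  have h := RatFunc.algebraMap_injective F h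
  have h1 : a ∣ c := hab.dvd_of_dvd_mul_right (h ▸ dvd_mul_right a e)
  have h2 : c ∣ a := hce.dvd_of_dvd_mul_right (h.symm ▸ dvd_mul_right c b)
  exact natDegree_eq_of_degree_eq (degree_eq_degree_of_associated (associated_of_dvd_dvd h1 h2))

end XCoordDoubling

/-- The duplication formula for the `x`-coordinate on `E_d`. -/
theorem curveE_two_nsmul_some {F : Type*} [Field F] [DecidableEq (RatFunc F)]
    (hF : ringChar F ≠ 2) {d : ℕ} {w : RatFunc F} (hw : w = RatFunc.X ^ (2 * d)) {x y : RatFunc F}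
    (hxy : (curveE F d).toAffine.Nonsingular x y) (hx : x * (x ^ 2 + w * x - 4 * w) ≠ 0) :
    ∃ y' h', 2 • WeierstrassCurve.Affine.Point.some x y hxy =
      .some ((x ^ 2 + 4 * w) ^ 2 / (4 * (x * (x ^ 2 + w * x - 4 * w)))) y' h' := by
  have h2 := ratFunc_two_ne_zero hF
  have hEq := (WeierstrassCurve.Affine.equation_iff _ _).mp hxy.1
  simp only [curveE, ← hw] at hEq
  have key : x * (x ^ 2 + w * x - 4 * w) = y ^ 2 := by linear_combination -hEq
  have hy0 : y ≠ 0 := by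
    rintro rfl
    exact hx (by rw [key]; ring)
  have hne : y ≠ (curveE F d).toAffine.negY x y := by
    simp only [WeierstrassCurve.Affine.negY, curveE]
    intro h
    have : 2 * y = 0 := by linear_combination h
    exact (mul_ne_zero h2 hy0) this
  have hX : (curveE F d).toAffine.addX x x ((curveE F d).toAffine.slope x x y y) =
      (x ^ 2 + 4 * w) ^ 2 / (4 * (x * (x ^ 2 + w * x - 4 * w))) := by
    rw [WeierstrassCurve.Affine.slope_of_Y_ne rfl hne, key]
    simp only [WeierstrassCurve.Affine.addX, WeierstrassCurve.Affine.negY, curveE, ← hw]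
    have e : y - (-y - 0 * x - 0) = 2 * y := by ring
    have h4 : (4 : RatFunc F) = 2 ^ 2 := by norm_num
    rw [e, h4, ← mul_pow, eq_div_iff (pow_ne_zero _ (mul_ne_zero h2 hy0))]
    field_simp
    linear_combination 4 * (w + 2 * x) * key
  rw [two_nsmul, WeierstrassCurve.Affine.Point.add_self_of_Y_ne hne, ← hX]
  exact ⟨_, _, rfl⟩

/-- Duplication on `E_d`, in terms of numerator and denominator of the `x`-coordinate. -/
theorem curveE_two_nsmul {F : Type*} [Field F] [DecidableEq (RatFunc F)] (hF : ringChar F ≠ 2)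
    (d : ℕ) {p : F[X] × F[X]} {Q : (curveE F d).toAffine.Point}
    (hB : (doubleX (X ^ (2 * d)) p).2 ≠ 0)
    (hQ : ∃ y h, Q = .some (algebraMap F[X] (RatFunc F) p.1 / algebraMap F[X] (RatFunc F) p.2)
      y h) :
    ∃ y h, 2 • Q = .some (algebraMap F[X] (RatFunc F) (doubleX (X ^ (2 * d)) p).1 /
      algebraMap F[X] (RatFunc F) (doubleX (X ^ (2 * d)) p).2) y h := by
  obtain ⟨y, hy, rfl⟩ := hQ
  have hD := RatFunc.algebraMap_ne_zero hB
  have hb : algebraMap F[X] (RatFunc F) p.2 ≠ 0 := by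
    refine RatFunc.algebraMap_ne_zero fun h ↦ hB ?_
    simp [doubleX, h]
  have hden (a b w : RatFunc F) (hb : b ≠ 0) :
      4 * a * b * (a ^ 2 + (w * a * b - 4 * w * b ^ 2)) =
        b ^ 4 * (4 * (a / b * ((a / b) ^ 2 + w * (a / b) - 4 * w))) := by
    field_simp
    ring
  have hnum (a b w : RatFunc F) (hb : b ≠ 0) :
      (a ^ 2 + 4 * w * b ^ 2) ^ 2 = b ^ 4 * ((a / b) ^ 2 + 4 * w) ^ 2 := by
    field_simp
  have hfst := Eq.trans
    (show algebraMap F[X] (RatFunc F) (doubleX (X ^ (2 * d)) p).1 = _ by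
      simp only [doubleX, map_mul, map_pow, map_add, map_ofNat, RatFunc.algebraMap_X])
    (hnum (algebraMap _ _ p.1) (algebraMap _ _ p.2) (RatFunc.X ^ (2 * d)) hb)
  have hsnd := Eq.trans
    (show algebraMap F[X] (RatFunc F) (doubleX (X ^ (2 * d)) p).2 = _ by
      simp only [doubleX, map_mul, map_pow, map_add, map_sub, map_ofNat, RatFunc.algebraMap_X])
    (hden (algebraMap _ _ p.1) (algebraMap _ _ p.2) (RatFunc.X ^ (2 * d)) hb)
  rw [hsnd] at hD
  rw [hfst, hsnd, mul_div_mul_left _ _ (pow_ne_zero 4 hb)]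
  exact curveE_two_nsmul_some hF rfl hy (right_ne_zero_of_mul (right_ne_zero_of_mul hD))

theorem isGoodFraction_doubleX_four_one {F : Type*} [Field F] (hF : ringChar F ≠ 2) {w : F[X]}
    (hw : 0 < w.natDegree) : IsGoodFraction w (doubleX w (4, 1)) := by
  have h4 := polynomial_isUnit_four hF
  have h256 : IsUnit (4 ^ 4 : F[X]) := h4.pow 4
  have unit256 (z : F[X]) : IsCoprime (4 ^ 4) z :=
    isCoprime_one_left.of_isCoprime_of_dvd_left h256.dvd
  have hden : (doubleX w (4, 1)).2 = 4 ^ 4 := by simp only [doubleX]; ring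
  refine ⟨?_, ?_, ?_, ?_, ?_⟩
  · rw [hden]
    exact (unit256 _).symm
  · refine (unit256 w).of_eq_add_mul (128 + 16 * w) ?_
    simp only [doubleX]; ring
  · refine (unit256 (w + 16)).of_eq_add_mul (16 * (w - 8)) ?_
    simp only [doubleX]; ring
  · rw [hden]
    exact h256.ne_zero
  · rw [hden, natDegree_eq_zero_of_isUnit h256]
    have hw0 : w ≠ 0 := by rintro rfl; simp at hw
    have e : (4 * w).natDegree = w.natDegree := by
      rw [natDegree_mul h4.ne_zero hw0, natDegree_ofNat, zero_add]
    have e4 : ((4 : F[X]) ^ 2).natDegree = 0 := natDegree_eq_zero_of_isUnit (h4.pow 2)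
    simp only [doubleX, one_pow, mul_one]
    rw [natDegree_pow, natDegree_add_eq_right_of_natDegree_lt (by rw [e, e4]; exact hw), e]
    omega

theorem pointP_not_isOfFinAddOrder {F : Type*} [Field F] [DecidableEq (RatFunc F)]
    (hF : ringChar F ≠ 2) {d : ℕ} (hd : 1 ≤ d) : ¬ IsOfFinAddOrder (pointP hF hd) := by
  have h4 := polynomial_isUnit_four hF
  set w : F[X] := X ^ (2 * d) with hw
  have hwdeg : 0 < w.natDegree := by rw [hw, natDegree_X_pow]; omega
  -- The orbit starts at `4P`: the constant `x(2P) = 4` has no pole at infinity, so `(4, 1)` is not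
  -- itself good.
  have hgood : IsGoodFraction w (doubleX w (4, 1)) := isGoodFraction_doubleX_four_one hF hwdeg
  have two : ∃ y h, 2 • pointP hF hd =
      .some (algebraMap F[X] (RatFunc F) 4 / algebraMap F[X] (RatFunc F) 1) y h := by
    have hden : (doubleX w (2 * X ^ d, 1)).2 = 4 * 4 * X ^ (4 * d) := by
      simp only [doubleX, hw]; ring
    obtain ⟨y, h, e⟩ := curveE_two_nsmul hF d (p := (2 * X ^ d, 1)) (Q := pointP hF hd)
      (by rw [← hw, hden]; exact mul_ne_zero (mul_ne_zero h4.ne_zero h4.ne_zero) (by simp))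
      ⟨_, by simpa [map_ofNat] using pointP_nonsingular hF hd, by simp [pointP, map_ofNat]⟩
    have hnum : (doubleX w (2 * X ^ d, 1)).1 = 4 * (4 * 4 * X ^ (4 * d)) := by
      simp only [doubleX, hw]; ring
    have hx : algebraMap F[X] (RatFunc F) (doubleX w (2 * X ^ d, 1)).1 /
        algebraMap F[X] (RatFunc F) (doubleX w (2 * X ^ d, 1)).2 =
        algebraMap F[X] (RatFunc F) 4 / algebraMap F[X] (RatFunc F) 1 := by
      have hne : (4 * 4 * X ^ (4 * d) : F[X]) ≠ 0 :=
        mul_ne_zero (mul_ne_zero h4.ne_zero h4.ne_zero) (by simp)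
      rw [hnum, hden, map_mul, map_one, div_one,
        mul_div_cancel_right₀ _ (RatFunc.algebraMap_ne_zero hne)]
    simp only [← hw, hx] at e
    exact ⟨_, _, e⟩
  have main (k : ℕ) : ∃ y h, 2 ^ (k + 2) • pointP hF hd =
      .some (algebraMap F[X] (RatFunc F) ((doubleX w)^[k] (doubleX w (4, 1))).1 /
        algebraMap F[X] (RatFunc F) ((doubleX w)^[k] (doubleX w (4, 1))).2) y h := by
    induction k with
    | zero =>
      rw [zero_add, pow_two, mul_nsmul]
      exact curveE_two_nsmul hF d hgood.snd_ne_zero two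
    | succ k ih =>
      rw [show k + 1 + 2 = k + 2 + 1 by ring, pow_succ, mul_nsmul, Function.iterate_succ_apply']
      refine curveE_two_nsmul hF d ?_ ih
      exact ((hgood.iterate_doubleX hF hwdeg k).doubleX hF hwdeg).1.snd_ne_zero
  intro hfin
  refine Set.infinite_of_injective_forall_mem (f := fun k : ℕ ↦ 2 ^ (k + 2) • pointP hF hd)
    (fun j k hjk ↦ ?_) (fun k ↦ (AddSubmonoid.mem_multiples_iff _ _).mpr ⟨_, rfl⟩)
    hfin.finite_multiples
  obtain ⟨y, h, e⟩ := main j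
  obtain ⟨y', h', e'⟩ := main k
  simp only [e, e', WeierstrassCurve.Affine.Point.some.injEq] at hjk
  have gj := hgood.iterate_doubleX hF hwdeg j
  have gk := hgood.iterate_doubleX hF hwdeg k
  exact (hgood.strictMono_natDegree hF hwdeg).injective
    (natDegree_eq_of_div_eq gj.isCoprime gk.isCoprime gj.snd_ne_zero gk.snd_ne_zero hjk.1)

theorem corollary1p6 {F : Type*} [Field F] [Finite F] (hF : ringChar F ≠ 2)
    [DecidableEq (RatFunc F)] (d : ℕ) (hd : 1 ≤ d) :
    ¬ IsOfFinAddOrder (pointP hF hd) ∧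
      0 < Module.rank ℤ (curveE F d).toAffine.Point := by
  have hP := pointP_not_isOfFinAddOrder hF hd
  refine ⟨hP, pos_iff_ne_zero.mpr fun h ↦ hP ?_⟩
  obtain ⟨n, hn, h0⟩ := rank_eq_zero_iff.mp h (pointP hF hd)
  exact isOfFinAddOrder_iff_zsmul_eq_zero.mpr ⟨n, hn, h0⟩
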